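/- Let $G$ be a compactly generated locally compact group with a continuous action by automorphisms on a locally finite tree $T$ (continuity meaning that vertex stabilizers are open in $G$). Suppose that for every vertex $v$ of $T$ the local action of $G$ at $v$, that is, the permutation group induced by the stabilizer of $v$ in $G$ on the set of edges of $T$ emanating from $v$, is nilpotent. Then $G$ fixes a vertex of $T$, or $G$ fixes an edge of $T$ (as an unoriented edge, possibly exchanging its two endpoints), or $G$ is virtually indicable, that is, $G$ has an open subgroup of finite index admitting a continuous surjective homomorphism onto the infinite cyclic group $\mathbf{Z}$. -/

import Mathlib

namespace TreeAction

/-- A topological group is compactly generated if some compact subset generates it as an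
abstract group. -/
def IsCompactlyGeneratedGroup (G : Type*) [Group G] [TopologicalSpace G] : Prop :=
  ∃ K : Set G, IsCompact K ∧ Subgroup.closure K = ⊤

/-- A topological group is virtually indicable if some open subgroup of finite index admits a
continuous surjective homomorphism onto the (discrete) infinite cyclic group. -/
def IsVirtuallyIndicable (G : Type*) [Group G] [TopologicalSpace G] : Prop :=
  ∃ H : Subgroup G, H.FiniteIndex ∧ IsOpen (H : Set G) ∧
    ∃ f : H →* Multiplicative ℤ, Continuous f ∧ Function.Surjective f

variable {G V : Type*} [Group G] [MulAction G V] {T : SimpleGraph V}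

/-- The action of `G` on the vertex set of the graph `T` is an action by graph automorphisms. -/
def ActsByAutomorphisms (G : Type*) {V : Type*} [Group G] [MulAction G V]
    (T : SimpleGraph V) : Prop :=
  ∀ (g : G) (v w : V), T.Adj (g • v) (g • w) ↔ T.Adj v w

/-- The homomorphism from the stabilizer of the vertex `v` to the symmetric group of the set of
edges emanating from `v`. As `T` is a simple graph, an edge emanating from `v` is recorded by its
other endpoint, a neighbor of `v`. -/
def localActionHom (hT : ActsByAutomorphisms G T) (v : V) :
    MulAction.stabilizer G v →* Equiv.Perm (T.neighborSet v) where
  toFun g := (MulAction.toPerm (g : G)).subtypeEquiv fun w => by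
    have h := hT (g : G) v w
    rw [MulAction.mem_stabilizer_iff.mp g.2] at h
    exact h.symm
  map_one' := by ext w; simp
  map_mul' g h := by ext w; exact mul_smul (g : G) (h : G) (w : V)

/-- The local action of `G` at the vertex `v`: the permutation group that the stabilizer of `v`
induces on the set of edges emanating from `v`. -/
def localAction (hT : ActsByAutomorphisms G T) (v : V) :
    Subgroup (Equiv.Perm (T.neighborSet v)) :=
  (localActionHom hT v).range

/-- `G` fixes a vertex of the graph. -/
def FixesVertex (G V : Type*) [Group G] [MulAction G V] : Prop :=
  ∃ v : V, ∀ g : G, g • v = v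

/-- `G` fixes an (unoriented) edge of `T`; its two endpoints may be exchanged. -/
def FixesEdge (G : Type*) {V : Type*} [Group G] [MulAction G V] (T : SimpleGraph V) : Prop :=
  ∃ e ∈ T.edgeSet, ∀ g : G, Sym2.map (fun v => g • v) e = e

end TreeAction

/-!
A compact generating set moves a vertex to finitely many vertices only, so the translates of a
finite subtree containing these form a connected invariant subgraph with finitely many orbits; take
a minimal one. Were one of its vertices a leaf, its orbit could be pruned, unless the subgraph is a
vertex or an edge, which `G` then fixes.

Otherwise every vertex `w` has degree at least two. If the stabilizer of `w` is transitive on the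
edges at `w`, nilpotency gives it a nontrivial character with values in `ℤ/p` that kills the
stabilizer of an edge. Such a character extends to `G`: it prescribes a flow on the edges of the
tree, and the potential of this flow is translated by each `g` up to a correction, hence changes by
a constant. The kernel of the extension is no longer transitive on the edges at `w`. Intersecting
finitely many such kernels gives an open subgroup `N` of finite index that is nowhere locally
transitive, and after passing to index two it has no inversions.

Without local transitivity a path can always be continued so that it does not backtrack modulo `N`.
As there are finitely many orbits, the path closes up modulo `N`, and a shortest closed piece leads
from `x` to `n • x` for some `n` in `N`, crossing the translates of its first edge exactly once.
Counting these crossings with sign is a homomorphism `N → ℤ` with value one at `n`.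
-/

namespace TreeAction

variable {G V A : Type*} [Group G] [MulAction G V] [AddCommGroup A] {T : SimpleGraph V}

theorem eq_of_forall_adj {α : Type*} (hT : T.Preconnected) (f : V → α)
    (hf : ∀ x y, T.Adj x y → f x = f y) (x y : V) : f x = f y := by
  obtain ⟨p⟩ := hT x y
  induction p with
  | nil => rfl
  | cons hadj _ ih => exact (hf _ _ hadj).trans ih

theorem exists_potential (hTree : T.IsTree) (c : V → V → A)
    (hc : ∀ x y, T.Adj x y → c y x = -c x y) :
    ∃ f : V → A, ∀ x y, T.Adj x y → f y - f x = c x y := by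
  obtain ⟨root⟩ := hTree.connected.nonempty
  choose p hp using fun x => (hTree.existsUnique_path root x).exists
  let f : V → A := fun x => ((p x).darts.map fun d => c d.fst d.snd).sum
  have sub_eq_of_mem_support : ∀ x y, T.Adj x y → x ∈ (p y).support → f y - f x = c x y := by
    intro x y hxy hx
    simp only [f, hTree.isAcyclic.path_concat (hp x) (hp y) hxy hx,
      SimpleGraph.Walk.darts_concat, List.concat_eq_append, List.map_append, List.map_cons,
      List.map_nil, List.sum_append, List.sum_singleton, add_sub_cancel_left]
  refine ⟨f, fun x y hxy => ?_⟩
  by_cases hx : x ∈ (p y).support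
  · exact sub_eq_of_mem_support x y hxy hx
  · have hy : y ∈ (p x).support :=
      hTree.isAcyclic.mem_support_of_ne_mem_support_of_adj_of_isPath (hp x) (hp y) hxy hx
    rw [← neg_sub, sub_eq_of_mem_support y x hxy.symm hy, hc x y hxy, neg_neg]

-- The quantity `f (g • x) - f x + σ g x` does not depend on `x`, and the cocycle identity makes it
-- multiplicative in `g`.
theorem exists_potential_and_hom (hTree : T.IsTree) (hact : ActsByAutomorphisms G T)
    (c : V → V → A) (hc : ∀ x y, T.Adj x y → c y x = -c x y) (σ : G → V → A)
    (hσ : ∀ g h x, σ (g * h) x = σ g (h • x) + σ h x)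
    (hcσ : ∀ g x y, T.Adj x y → c (g • x) (g • y) = c x y + σ g x - σ g y) :
    ∃ (f : V → A) (φ : G →* Multiplicative A), (∀ x y, T.Adj x y → f y - f x = c x y) ∧
      ∀ g x, φ g = .ofAdd (f (g • x) - f x + σ g x) := by
  obtain ⟨f, hf⟩ := exists_potential hTree c hc
  obtain ⟨root⟩ := hTree.connected.nonempty
  let D : G → V → A := fun g x => f (g • x) - f x + σ g x
  have D_mul : ∀ g h x, D (g * h) x = D g (h • x) + D h x := fun g h x => by
    simp only [D, hσ, mul_smul]
    abel
  have D_const : ∀ g x y, D g x = D g y := fun g =>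
    eq_of_forall_adj hTree.connected.preconnected (D g) fun x y hxy => by
      have hgxy := hf _ _ ((hact g x y).mpr hxy)
      rw [hcσ g x y hxy, ← hf x y hxy, sub_eq_iff_eq_add] at hgxy
      simp only [D, hgxy]
      abel
  let φ : G →* Multiplicative A := MonoidHom.mk' (fun g => .ofAdd (D g root)) fun g h => by
    rw [D_mul, D_const g (h • root) root, ofAdd_add]
  exact ⟨f, φ, hf, fun g x => congrArg Multiplicative.ofAdd (D_const g root x)⟩

theorem exists_potential_and_hom_of_invariant (hTree : T.IsTree) (hact : ActsByAutomorphisms G T)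
    (c : V → V → A) (hc : ∀ x y, T.Adj x y → c y x = -c x y)
    (hcG : ∀ (g : G) x y, c (g • x) (g • y) = c x y) :
    ∃ (f : V → A) (φ : G →* Multiplicative A), (∀ x y, T.Adj x y → f y - f x = c x y) ∧
      ∀ g x, φ g = .ofAdd (f (g • x) - f x) := by
  simpa only [add_zero] using exists_potential_and_hom hTree hact c hc (fun _ _ => 0)
    (fun _ _ _ => (add_zero 0).symm) (fun g x y _ => by rw [hcG, add_sub_cancel_right])

/-- The action has no inversions in Serre's sense: no group element exchanges the endpoints of an
edge. -/
def ActsWithoutInversions (G : Type*) {V : Type*} [Group G] [MulAction G V]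
    (T : SimpleGraph V) : Prop :=
  ∀ (g : G) (x : V), T.Adj x (g • x) → g • g • x ≠ x

/-- The stabilizer of `w` acts transitively on the edges emanating from `w`. -/
def LocallyTransitive (G : Type*) {V : Type*} [Group G] [MulAction G V]
    (T : SimpleGraph V) (w : V) : Prop :=
  ∀ x y, T.Adj w x → T.Adj w y → ∃ g : G, g • w = w ∧ g • x = y

theorem isSimpleGroup_quotient_of_isCoatom {Q : Type*} [Group Q] {M : Subgroup Q} [M.Normal]
    (hM : IsCoatom M) : IsSimpleGroup (Q ⧸ M) := by
  have : Nontrivial (Q ⧸ M) := QuotientGroup.nontrivial_iff.mpr hM.1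
  have : IsSimpleOrder (Set.Ici M) := Set.isSimpleOrder_Ici_iff_isCoatom.mpr hM
  let e : Subgroup (Q ⧸ M) ≃o Set.Ici M := QuotientGroup.comapMk'OrderIso M
  have : IsSimpleOrder (Subgroup (Q ⧸ M)) := e.isSimpleOrder
  exact ⟨fun N _ => eq_bot_or_eq_top N⟩

theorem exists_prime_character_of_ne_top {Q : Type*} [Group Q] [Group.IsNilpotent Q]
    [IsCoatomic (Subgroup Q)] {L : Subgroup Q} (hL : L ≠ ⊤) :
    ∃ p : ℕ, p.Prime ∧ ∃ χ : Q →* Multiplicative (ZMod p), L ≤ χ.ker ∧ Function.Surjective χ := by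
  obtain ⟨M, hM, hLM⟩ := (eq_top_or_exists_le_coatom L).resolve_left hL
  have : M.Normal :=
    Subgroup.NormalizerCondition.normal_of_coatom M Group.normalizerCondition_of_isNilpotent hM
  have := isSimpleGroup_quotient_of_isCoatom hM
  obtain ⟨p, hp, ⟨e⟩⟩ := exists_prime_addEquiv_ZMod (G := Q ⧸ M)
  let e' : Q ⧸ M ≃* Multiplicative (ZMod p) := AddEquiv.toMultiplicativeRight e
  refine ⟨p, hp, (e' : Q ⧸ M →* _).comp (QuotientGroup.mk' M), ?_,
    e'.surjective.comp (QuotientGroup.mk'_surjective M)⟩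
  rw [MonoidHom.ker_mulEquiv_comp, QuotientGroup.ker_mk']
  exact hLM

theorem exists_map_mul_eq_add {S : Subgroup G} (χ : S →* Multiplicative A) :
    ∃ F : G → A, ∀ (a : G) (k : S), F (a * k) = F a + (χ k).toAdd := by
  have out_inv_mul_mem : ∀ a : G, (a : G ⧸ S).out⁻¹ * a ∈ S := fun a =>
    QuotientGroup.eq.mp (QuotientGroup.out_eq' (a : G ⧸ S))
  refine ⟨fun a => (χ ⟨_, out_inv_mul_mem a⟩).toAdd, fun a k => ?_⟩
  rw [← toAdd_mul, ← map_mul]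
  refine congrArg (fun k' => (χ k').toAdd) (Subtype.ext ?_)
  simp only [QuotientGroup.mk_mul_of_mem a k.2, Subgroup.coe_mul, mul_assoc]

theorem exists_map_smul_eq {X : Type*} [MulAction G X] (x : X) (F : G → A)
    (hF : ∀ a : G, ∀ k ∈ MulAction.stabilizer G x, F (a * k) = F a) :
    ∃ l : X → A, (∀ a : G, l (a • x) = F a) ∧ ∀ y ∉ MulAction.orbit G x, l y = 0 := by
  have hfactors : F.FactorsThrough fun a : G => a • x := fun a b (hab : a • x = b • x) => by
    rw [← hF b (b⁻¹ * a) (by rw [MulAction.mem_stabilizer_iff, mul_smul, hab, inv_smul_smul]),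
      mul_inv_cancel_left]
  exact ⟨Function.extend (fun a : G => a • x) F fun _ => 0, hfactors.extend_apply _,
    fun y hy => Function.extend_apply' F _ y hy⟩

theorem smul_mem_orbit_iff {X : Type*} [MulAction G X] (g : G) {x y : X} :
    g • y ∈ MulAction.orbit G x ↔ y ∈ MulAction.orbit G x := by
  rw [← MulAction.orbit_eq_iff, MulAction.orbit_smul, MulAction.orbit_eq_iff]

theorem LocallyTransitive.exists_smul_eq {w x₀ x y : V} (hw : LocallyTransitive G T w)
    (hact : ActsByAutomorphisms G T) (hadj : T.Adj w x₀) (hx : x ∈ MulAction.orbit G w)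
    (hxy : T.Adj x y) : ∃ a : G, a • w = x ∧ a • x₀ = y := by
  obtain ⟨b, rfl⟩ := hx
  have hb : T.Adj w (b⁻¹ • y) := by rwa [← hact b, smul_inv_smul]
  obtain ⟨k, hkw, hkx₀⟩ := hw _ _ hadj hb
  exact ⟨b * k, by rw [mul_smul, hkw], by rw [mul_smul, hkx₀, smul_inv_smul]⟩

-- Label the edge `(a • w, a • x₀)` by `F a`, where `F (a * k) = F a + χ k` for `k` fixing `w`: then
-- translation by `g` changes the labels of all edges at a given vertex by the same amount.
theorem exists_label_of_locallyTransitive (hact : ActsByAutomorphisms G T) {w x₀ : V}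
    (hadj : T.Adj w x₀) (hw : LocallyTransitive G T w)
    (χ : MulAction.stabilizer G w →* Multiplicative A)
    (hχ : ∀ g : MulAction.stabilizer G w, (g : G) • x₀ = x₀ → χ g = 1) :
    ∃ (label : V × V → A) (σ : G → V → A),
      (∀ g x y, T.Adj x y → label (g • x, g • y) = label (x, y) + σ g x) ∧
        (∀ g h x, σ (g * h) x = σ g (h • x) + σ h x) ∧
          ∀ g : MulAction.stabilizer G w, σ g w = (χ g).toAdd := by
  obtain ⟨F, hF⟩ := exists_map_mul_eq_add χ
  obtain ⟨label, hlabel, hlabel_zero⟩ := exists_map_smul_eq (w, x₀) F fun a k hk => by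
    obtain ⟨hkw, hkx₀⟩ := Prod.ext_iff.mp hk
    rw [hF a ⟨k, hkw⟩, hχ ⟨k, hkw⟩ hkx₀, toAdd_one, add_zero]
  choose σ hσ hσ_zero using fun g : G =>
    exists_map_smul_eq w (fun a => F (g * a) - F a) fun a k hk => by
      rw [← mul_assoc, hF _ ⟨k, hk⟩, hF _ ⟨k, hk⟩, add_sub_add_right_eq_sub]
  refine ⟨label, σ, fun g x y hxy => ?_, fun g h x => ?_, fun g => ?_⟩
  · by_cases hx : x ∈ MulAction.orbit G w
    · obtain ⟨a, rfl, rfl⟩ := hw.exists_smul_eq hact hadj hx hxy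
      have hga := hlabel (g * a)
      have ha := hlabel a
      simp only [Prod.smul_mk, mul_smul] at hga ha
      rw [hga, ha, hσ, add_sub_cancel]
    · have label_eq_zero : ∀ x' ∉ MulAction.orbit G w, ∀ y', label (x', y') = 0 :=
        fun x' hx' y' => hlabel_zero _ fun ⟨a, ha⟩ => hx' ⟨a, congrArg Prod.fst ha⟩
      rw [label_eq_zero _ hx, label_eq_zero _ (mt (smul_mem_orbit_iff g).mp hx), hσ_zero g x hx,
        add_zero]
  · by_cases hx : x ∈ MulAction.orbit G w
    · obtain ⟨a, rfl⟩ := hx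
      simp only [hσ, ← mul_smul, ← mul_assoc, sub_add_sub_cancel]
    · rw [hσ_zero _ x hx, hσ_zero _ x hx, hσ_zero _ _ (mt (smul_mem_orbit_iff h).mp hx), add_zero]
  · have hFg := hF 1 g
    rw [one_mul] at hFg
    simpa only [one_smul, mul_one, hFg, add_sub_cancel_left] using hσ g 1

theorem exists_hom_extending_of_locallyTransitive (hTree : T.IsTree)
    (hact : ActsByAutomorphisms G T) {w x₀ : V} (hadj : T.Adj w x₀)
    (hw : LocallyTransitive G T w) (χ : MulAction.stabilizer G w →* Multiplicative A)
    (hχ : ∀ g : MulAction.stabilizer G w, (g : G) • x₀ = x₀ → χ g = 1) :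
    ∃ φ : G →* Multiplicative A, ∀ g : MulAction.stabilizer G w, φ g = χ g := by
  obtain ⟨label, σ, label_smul, σ_mul, hσ⟩ := exists_label_of_locallyTransitive hact hadj hw χ hχ
  have flow_smul : ∀ g x y, T.Adj x y → label (g • x, g • y) - label (g • y, g • x) =
      label (x, y) - label (y, x) + σ g x - σ g y := fun g x y hxy => by
    rw [label_smul g x y hxy, label_smul g y x hxy.symm]
    abel
  obtain ⟨f, φ, -, hφ⟩ := exists_potential_and_hom hTree hact
    (fun x y => label (x, y) - label (y, x)) (fun _ _ _ => (neg_sub _ _).symm) σ σ_mul flow_smul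
  refine ⟨φ, fun g => ?_⟩
  rw [hφ g w, MulAction.mem_stabilizer_iff.mp g.2, sub_self, zero_add, hσ, ofAdd_toAdd]

/-- A substitute for nilpotency of the local actions: whenever an edge emanating from `w` is moved
by the stabilizer of `w`, this stabilizer has a quotient of prime order in which the stabilizer of
the edge becomes trivial. -/
def HasLocalCharacters (G : Type*) {V : Type*} [Group G] [MulAction G V]
    (T : SimpleGraph V) : Prop :=
  ∀ w x, T.Adj w x → (∃ g : G, g • w = w ∧ g • x ≠ x) →
    ∃ p : ℕ, p.Prime ∧ ∃ χ : MulAction.stabilizer G w →* Multiplicative (ZMod p),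
      (∀ g : MulAction.stabilizer G w, (g : G) • x = x → χ g = 1) ∧ χ ≠ 1

theorem ActsByAutomorphisms.subgroup (hact : ActsByAutomorphisms G T) (N : Subgroup G) :
    ActsByAutomorphisms N T :=
  fun n => hact n

theorem not_locallyTransitive_ker (hact : ActsByAutomorphisms G T) {B : Type*} [Group B]
    {w x : V} (hadj : T.Adj w x) (φ : G →* B)
    (hφ : ∀ g : G, g • w = w → g • x = x → φ g = 1) {g : G} (hgw : g • w = w) (hg : φ g ≠ 1) :
    ¬LocallyTransitive φ.ker T w := by
  intro htrans
  have hgx : T.Adj w (g • x) := by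
    have := (hact g w x).mpr hadj
    rwa [hgw] at this
  obtain ⟨⟨n, hn⟩, hnw, hnx⟩ := htrans x (g • x) hadj hgx
  change n • w = w at hnw
  change n • x = g • x at hnx
  have hker : φ (n⁻¹ * g) = 1 := hφ _
    (by rw [mul_smul, hgw, inv_smul_eq_iff, hnw]) (by rw [mul_smul, ← hnx, inv_smul_smul])
  rw [map_mul, map_inv, MonoidHom.mem_ker.mp hn, inv_one, one_mul] at hker
  exact hg hker

theorem LocallyTransitive.of_normal_smul (hact : ActsByAutomorphisms G T) (N : Subgroup G)
    [hN : N.Normal] (g : G) {w : V} (hw : LocallyTransitive N T (g • w)) :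
    LocallyTransitive N T w := by
  intro x y hx hy
  obtain ⟨⟨n, hn⟩, hnw, hnx⟩ := hw (g • x) (g • y) ((hact g w x).mpr hx) ((hact g w y).mpr hy)
  refine ⟨⟨g⁻¹ * n * g, by simpa using hN.conj_mem n hn g⁻¹⟩, ?_, ?_⟩
  · change (g⁻¹ * n * g) • w = w
    rw [mul_smul, mul_smul, inv_smul_eq_iff]
    exact hnw
  · change (g⁻¹ * n * g) • x = y
    rw [mul_smul, mul_smul, inv_smul_eq_iff]
    exact hnx

theorem LocallyTransitive.mono {H K : Subgroup G} (hHK : H ≤ K) {w : V}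
    (hw : LocallyTransitive H T w) : LocallyTransitive K T w := fun x y hx hy =>
  let ⟨h, hhw, hhx⟩ := hw x y hx hy
  ⟨⟨h, hHK h.2⟩, hhw, hhx⟩

section Topology

variable [TopologicalSpace G] [IsTopologicalGroup G]

theorem exists_normal_not_locallyTransitive (hTree : T.IsTree) (hact : ActsByAutomorphisms G T)
    (hopen : ∀ v : V, IsOpen (MulAction.stabilizer G v : Set G)) (hloc : HasLocalCharacters G T)
    {w : V} (hw : (T.neighborSet w).Nontrivial) :
    ∃ N : Subgroup G, N.Normal ∧ N.FiniteIndex ∧ IsOpen (N : Set G) ∧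
      ¬LocallyTransitive N T w := by
  by_cases htrans : LocallyTransitive G T w
  · obtain ⟨x, hx, y, hy, hxy⟩ := hw
    obtain ⟨a, haw, hax⟩ := htrans x y hx hy
    obtain ⟨p, hp, χ, hχ, hχ_ne⟩ := hloc w x hx ⟨a, haw, fun h => hxy (h.symm.trans hax)⟩
    obtain ⟨φ, hφ⟩ := exists_hom_extending_of_locallyTransitive hTree hact hx htrans χ hχ
    have φ_eq_one : ∀ g : G, g • w = w → g • x = x → φ g = 1 := fun g hgw hgx =>
      (hφ ⟨g, hgw⟩).trans (hχ ⟨g, hgw⟩ hgx)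
    obtain ⟨g, hg⟩ := DFunLike.ne_iff.mp hχ_ne
    have := Fact.mk hp
    have : Finite (Multiplicative (ZMod p)) := inferInstanceAs (Finite (ZMod p))
    exact ⟨φ.ker, inferInstance, inferInstance,
      Subgroup.isOpen_mono (H₁ := MulAction.stabilizer G w ⊓ MulAction.stabilizer G x)
        (fun g hg => φ_eq_one g hg.1 hg.2) ((hopen w).inter (hopen x)),
      not_locallyTransitive_ker hact hx φ φ_eq_one g.2 ((hφ g).trans_ne hg)⟩
  · exact ⟨⊤, inferInstance, inferInstance, isOpen_univ,
      fun h => htrans fun x y hx hy => let ⟨g, hg⟩ := h x y hx hy; ⟨g, hg⟩⟩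

theorem exists_finiteIndex_actsWithoutInversions (hTree : T.IsTree) (hact : ActsByAutomorphisms G T)
    (hopen : ∀ v : V, IsOpen (MulAction.stabilizer G v : Set G)) :
    ∃ P : Subgroup G, P.FiniteIndex ∧ IsOpen (P : Set G) ∧ ActsWithoutInversions P T := by
  obtain ⟨f, φ, hf, hφ⟩ := exists_potential_and_hom_of_invariant hTree hact
    (fun _ _ => (1 : ZMod 2)) (fun _ _ _ => by decide) fun _ _ _ => rfl
  obtain ⟨v⟩ := hTree.connected.nonempty
  have : Finite (Multiplicative (ZMod 2)) := inferInstanceAs (Finite (ZMod 2))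
  refine ⟨φ.ker, inferInstance,
    Subgroup.isOpen_mono (H₁ := MulAction.stabilizer G v) (fun g hg => ?_) (hopen v), ?_⟩
  · rw [MonoidHom.mem_ker, hφ g v, MulAction.mem_stabilizer_iff.mp hg, sub_self, ofAdd_zero]
  · rintro ⟨g, hg⟩ x hgx -
    have hone : φ g = .ofAdd 1 := (hφ g x).trans (congrArg _ (hf x (g • x) hgx))
    rw [MonoidHom.mem_ker.mp hg] at hone
    exact absurd hone (by decide)

end Topology

theorem exists_shortest_return {α : Type*} [Finite α] (π : ℕ → α) :
    ∃ m n, 0 < n ∧ π (m + n) = π m ∧ ∀ i j, i < j → j < i + n → π i ≠ π j := by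
  classical
  have exists_return : ∃ n, 0 < n ∧ ∃ m, π (m + n) = π m := by
    obtain ⟨i, j, hij, hπ⟩ := Finite.exists_ne_map_eq_of_infinite π
    rcases hij.lt_or_gt with hlt | hlt
    · exact ⟨j - i, by lia, i, by rw [Nat.add_sub_cancel' hlt.le, hπ]⟩
    · exact ⟨i - j, by lia, j, by rw [Nat.add_sub_cancel' hlt.le, hπ]⟩
  obtain ⟨hpos, m, hm⟩ := Nat.find_spec exists_return
  refine ⟨m, Nat.find exists_return, hpos, hm, fun i j hij hj hπ => ?_⟩
  refine Nat.find_min exists_return (m := j - i) (by lia) ⟨by lia, i, ?_⟩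
  rw [Nat.add_sub_cancel' hij.le, hπ]

theorem exists_adj_forall_smul_ne {w : V} (hw : ¬LocallyTransitive G T w) (y : V) :
    ∃ z, T.Adj w z ∧ ∀ g : G, g • w = w → g • y ≠ z := by
  by_contra! hcon
  refine hw fun a b ha hb => ?_
  obtain ⟨g, hgw, rfl⟩ := hcon a ha
  obtain ⟨h, hhw, rfl⟩ := hcon b hb
  exact ⟨h * g⁻¹, by rw [mul_smul, inv_smul_eq_iff.mpr hgw.symm, hhw],
    by rw [mul_smul, inv_smul_smul]⟩

theorem exists_ray_forall_smul_ne [Nonempty V] (hG : ∀ w, ¬LocallyTransitive G T w) :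
    ∃ x : ℕ → V, (∀ n, T.Adj (x n) (x (n + 1))) ∧
      ∀ n, ∀ g : G, g • x (n + 1) = x (n + 1) → g • x n ≠ x (n + 2) := by
  obtain ⟨v⟩ := ‹Nonempty V›
  choose next hadj hnext using fun w => exists_adj_forall_smul_ne (hG w)
  let edge : ℕ → V × V := Nat.rec (v, next v v) fun _ e => (e.2, next e.2 e.1)
  refine ⟨fun n => (edge n).1, fun n => ?_, fun n => hnext _ _⟩
  cases n with
  | zero => exact hadj v v
  | succ n => exact hadj _ _

theorem exists_closed_path [Nonempty V] [Finite (MulAction.orbitRel.Quotient G V)]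
    (hG : ∀ w, ¬LocallyTransitive G T w) :
    ∃ (x : ℕ → V) (n : ℕ) (g : G), 0 < n ∧ g • x 0 = x n ∧ (∀ i, T.Adj (x i) (x (i + 1))) ∧
      (∀ i, ∀ h : G, h • x (i + 1) = x (i + 1) → h • x i ≠ x (i + 2)) ∧
      ∀ i j, i < j → j < i + n → ∀ h : G, h • x i ≠ x j := by
  obtain ⟨x, hadj, hx⟩ := exists_ray_forall_smul_ne hG
  obtain ⟨m, n, hn, hmn, hmin⟩ :=
    exists_shortest_return fun i => (Quotient.mk'' (x i) : MulAction.orbitRel.Quotient G V)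
  obtain ⟨g, hg⟩ : x (m + n) ∈ MulAction.orbit G (x m) := Quotient.eq''.mp hmn
  refine ⟨fun i => x (m + i), n, g, hn, hg, fun i => hadj (m + i), fun i => hx (m + i), ?_⟩
  intro i j hij hj h hhij
  exact hmin (m + i) (m + j) (by lia) (by lia)
    (Quotient.eq''.mpr (MulAction.mem_orbit_symm.mp ⟨h, hhij⟩))

/-- The `G`-invariant flow of strength one along the translates of the oriented edge `(a, b)`: its
potential measures how often a path crosses these translates, counted with sign. -/
noncomputable def orbitFlow (G : Type*) {V : Type*} [Group G] [MulAction G V] (a b x y : V) : ℤ :=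
  (MulAction.orbit G (a, b)).indicator 1 (x, y) - (MulAction.orbit G (a, b)).indicator 1 (y, x)

theorem orbitFlow_swap (a b x y : V) : orbitFlow G a b y x = -orbitFlow G a b x y :=
  (neg_sub _ _).symm

theorem orbitFlow_smul (g : G) (a b x y : V) :
    orbitFlow G a b (g • x) (g • y) = orbitFlow G a b x y := by
  have indicator_smul (e : V × V) : (MulAction.orbit G (a, b)).indicator (1 : V × V → ℤ) (g • e) =
      (MulAction.orbit G (a, b)).indicator 1 e :=
    Set.indicator_eq_indicator (smul_mem_orbit_iff g) rfl
  exact congrArg₂ (· - ·) (indicator_smul (x, y)) (indicator_smul (y, x))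

theorem sum_orbitFlow_eq_one (hinv : ActsWithoutInversions G T) {x : ℕ → V} {n : ℕ} (hn : 0 < n)
    (hadj : T.Adj (x 0) (x 1)) (hback : ∀ g : G, g • x 1 = x 1 → g • x 0 ≠ x 2)
    (hmin : ∀ i j, i < j → j < i + n → ∀ g : G, g • x i ≠ x j) :
    ∑ i ∈ Finset.range n, orbitFlow G (x 0) (x 1) (x i) (x (i + 1)) = 1 := by
  have not_forward : ∀ i, 0 < i → i < n → (x i, x (i + 1)) ∉ MulAction.orbit G (x 0, x 1) := by
    rintro i hi hin ⟨g, hg⟩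
    exact hmin 0 i hi (by lia) g (congrArg Prod.fst hg)
  have not_backward : ∀ i < n, (x (i + 1), x i) ∉ MulAction.orbit G (x 0, x 1) := by
    rintro i hi ⟨g, hg⟩
    obtain ⟨hg₀, hg₁⟩ : g • x 0 = x (i + 1) ∧ g • x 1 = x i := Prod.ext_iff.mp hg
    obtain rfl | rfl | hi₁ : i = 0 ∨ i = 1 ∨ 1 < i := by lia
    · exact hinv g (x 0) (by rwa [hg₀]) (by rw [hg₀, hg₁])
    · exact hback g hg₁ hg₀
    · exact hmin 1 i hi₁ (by lia) g hg₁
  rw [Finset.sum_eq_single 0]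
  · rw [orbitFlow, Set.indicator_of_mem (MulAction.mem_orbit_self _),
      Set.indicator_of_notMem (not_backward 0 hn), Pi.one_apply, sub_zero]
  · intro i hi hi₀
    rw [Finset.mem_range] at hi
    rw [orbitFlow, Set.indicator_of_notMem (not_forward i (by lia) hi),
      Set.indicator_of_notMem (not_backward i hi), sub_zero]
  · simp [hn]

theorem exists_surjective_hom_int (hTree : T.IsTree) (hact : ActsByAutomorphisms G T)
    (hinv : ActsWithoutInversions G T) [Finite (MulAction.orbitRel.Quotient G V)]
    (hG : ∀ w, ¬LocallyTransitive G T w) :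
    ∃ φ : G →* Multiplicative ℤ, Function.Surjective φ ∧
      ∀ v : V, MulAction.stabilizer G v ≤ φ.ker := by
  have := hTree.connected.nonempty
  obtain ⟨x, n, g, hn, hg, hadj, hback, hmin⟩ := exists_closed_path hG
  obtain ⟨f, φ, hf, hφ⟩ := exists_potential_and_hom_of_invariant hTree hact
    (orbitFlow G (x 0) (x 1)) (fun _ _ _ => orbitFlow_swap _ _ _ _) fun h => orbitFlow_smul h _ _
  have hφg : φ g = .ofAdd 1 := by
    rw [hφ g (x 0), hg, ← Finset.sum_range_sub (fun i => f (x i)) n,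
      Finset.sum_congr rfl fun i _ => hf _ _ (hadj i),
      sum_orbitFlow_eq_one hinv hn (hadj 0) (hback 0) hmin]
  refine ⟨φ, fun k => ⟨g ^ k.toAdd, ?_⟩, fun v h hh => ?_⟩
  · rw [map_zpow, hφg, ← ofAdd_zsmul, smul_eq_mul, mul_one, ofAdd_toAdd]
  · rw [MonoidHom.mem_ker, hφ h v, MulAction.mem_stabilizer_iff.mp hh, sub_self, ofAdd_zero]

section Topology

variable [TopologicalSpace G] [IsTopologicalGroup G]

theorem continuous_of_isOpen_le_ker {B : Type*} [Group B] [TopologicalSpace B] [DiscreteTopology B]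
    (φ : G →* B) {U : Subgroup G} (hU : IsOpen (U : Set G)) (hUφ : U ≤ φ.ker) : Continuous φ := by
  refine continuous_of_continuousAt_one φ (tendsto_nhds_of_eventually_eq ?_)
  filter_upwards [hU.mem_nhds U.one_mem] with g hg
  rw [map_one, MonoidHom.mem_ker.mp (hUφ hg)]

theorem exists_finiteIndex_forall_not_locallyTransitive (hTree : T.IsTree)
    (hact : ActsByAutomorphisms G T)
    (hopen : ∀ v : V, IsOpen (MulAction.stabilizer G v : Set G)) (hloc : HasLocalCharacters G T)
    [Finite (MulAction.orbitRel.Quotient G V)] (hdeg : ∀ w, (T.neighborSet w).Nontrivial) :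
    ∃ N : Subgroup G, N.FiniteIndex ∧ IsOpen (N : Set G) ∧ ∀ w, ¬LocallyTransitive N T w := by
  choose N hN hNfin hNopen hNtrans using fun w =>
    exists_normal_not_locallyTransitive hTree hact hopen hloc (hdeg w)
  refine ⟨⨅ ω : MulAction.orbitRel.Quotient G V, N ω.out,
    Subgroup.finiteIndex_iInf fun ω => hNfin ω.out, ?_, fun w hw => ?_⟩
  · rw [Subgroup.coe_iInf]
    exact isOpen_iInter_of_finite fun ω => hNopen ω.out
  · let ω : MulAction.orbitRel.Quotient G V := Quotient.mk'' w
    obtain ⟨g, hg⟩ : w ∈ MulAction.orbit G ω.out :=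
      MulAction.mem_orbit_symm.mp (Quotient.mk_out (s := MulAction.orbitRel G V) w)
    have := hN ω.out
    refine hNtrans ω.out (LocallyTransitive.of_normal_smul hact (N ω.out) g ?_)
    rw [show g • ω.out = w from hg]
    exact hw.mono (iInf_le (fun ω : MulAction.orbitRel.Quotient G V => N ω.out) ω)

theorem isVirtuallyIndicable_of_hasLocalCharacters (hTree : T.IsTree)
    (hact : ActsByAutomorphisms G T)
    (hopen : ∀ v : V, IsOpen (MulAction.stabilizer G v : Set G)) (hloc : HasLocalCharacters G T)
    [Finite (MulAction.orbitRel.Quotient G V)] (hdeg : ∀ w, (T.neighborSet w).Nontrivial) :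
    IsVirtuallyIndicable G := by
  obtain ⟨P, hPfin, hPopen, hP⟩ := exists_finiteIndex_actsWithoutInversions hTree hact hopen
  obtain ⟨N, hNfin, hNopen, hN⟩ :=
    exists_finiteIndex_forall_not_locallyTransitive hTree hact hopen hloc hdeg
  have hfin : (P ⊓ N).FiniteIndex := inferInstance
  have : Finite (MulAction.orbitRel.Quotient (P ⊓ N : Subgroup G) V) :=
    Subgroup.finite_quotient_of_finite_quotient_of_index_ne_zero hfin.index_ne_zero
  obtain ⟨φ, hφ, hφ_stab⟩ := exists_surjective_hom_int (G := (P ⊓ N : Subgroup G)) hTree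
    (hact.subgroup _) (fun g => hP ⟨g, g.2.1⟩) fun w hw => hN w (hw.mono inf_le_right)
  obtain ⟨v⟩ := hTree.connected.nonempty
  exact ⟨P ⊓ N, hfin, hPopen.inter hNopen, φ,
    continuous_of_isOpen_le_ker φ ((hopen v).preimage continuous_subtype_val) (hφ_stab v), hφ⟩

end Topology

/-- The union of a finite set of orbits, as an invariant set of vertices. -/
def orbitUnion (Ω : Finset (MulAction.orbitRel.Quotient G V)) : SubMulAction G V where
  carrier := {v | (Quotient.mk'' v : MulAction.orbitRel.Quotient G V) ∈ Ω}
  smul_mem' g v hv := by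
    have hgv : (Quotient.mk'' (g • v) : MulAction.orbitRel.Quotient G V) = Quotient.mk'' v :=
      Quotient.sound (MulAction.mem_orbit v g)
    change _ ∈ Ω
    rwa [hgv]

theorem finite_quotient_orbitUnion (Ω : Finset (MulAction.orbitRel.Quotient G V)) :
    Finite (MulAction.orbitRel.Quotient G (orbitUnion Ω)) := by
  have lift_rel : ∀ v w : orbitUnion Ω, MulAction.orbitRel G (orbitUnion Ω) v w ↔
      MulAction.orbitRel G V v w := fun v w => SubMulAction.mem_orbit_subMul_iff
  let ι : MulAction.orbitRel.Quotient G (orbitUnion Ω) → Ω :=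
    Quotient.lift (fun v => ⟨Quotient.mk'' (v : V), v.2⟩) fun v w h =>
      Subtype.ext (Quotient.sound ((lift_rel v w).mp h))
  refine Finite.of_injective ι fun a b => ?_
  induction a, b using Quotient.inductionOn₂ with | _ v w =>
  exact fun h => Quotient.sound ((lift_rel v w).mpr (Quotient.exact (congrArg Subtype.val h)))

theorem ActsByAutomorphisms.induce (hact : ActsByAutomorphisms G T) (X : SubMulAction G V) :
    ActsByAutomorphisms (V := X) G (T.induce (X : Set V)) :=
  fun g v w => hact g v w

theorem ActsByAutomorphisms.reachable_smul (hact : ActsByAutomorphisms G T) (g : G) {v w : V}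
    (h : T.Reachable v w) : T.Reachable (g • v) (g • w) :=
  h.map ⟨(g • ·), fun {x y} => (hact g x y).mpr⟩

theorem exists_connected_orbitUnion [TopologicalSpace G] [TopologicalSpace V] [DiscreteTopology V]
    [ContinuousSMul G V] (hG : IsCompactlyGeneratedGroup G) (hconn : T.Connected)
    (hact : ActsByAutomorphisms G T) :
    ∃ Ω : Finset (MulAction.orbitRel.Quotient G V),
      (T.induce (orbitUnion Ω : Set V)).Connected := by
  classical
  obtain ⟨K, hK, hKtop⟩ := hG
  obtain ⟨v₀⟩ := hconn.nonempty
  have hKfin : ((fun g : G => g • v₀) '' K).Finite :=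
    (hK.image (continuous_id.smul continuous_const)).finite_of_discrete
  obtain ⟨t, hst, ht⟩ := SimpleGraph.extend_finset_to_connected hconn.preconnected
    (Finset.insert_nonempty v₀ hKfin.toFinset)
  let Ω : Finset (MulAction.orbitRel.Quotient G V) := t.image Quotient.mk''
  have t_subset : (t : Set V) ⊆ orbitUnion Ω := fun v hv => Finset.mem_image_of_mem _ hv
  have hv₀ : v₀ ∈ t := hst (Finset.mem_insert_self _ _)
  let base : orbitUnion Ω := ⟨v₀, t_subset hv₀⟩
  have hactΩ := hact.induce (orbitUnion Ω)
  have reachable_of_mem : ∀ v (hv : v ∈ t),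
      (T.induce (orbitUnion Ω : Set V)).Reachable base ⟨v, t_subset hv⟩ := fun v hv =>
    (ht.preconnected ⟨v₀, hv₀⟩ ⟨v, hv⟩).map (SimpleGraph.induceHomOfLE T t_subset).toHom
  have reachable_smul : ∀ g : G, (T.induce (orbitUnion Ω : Set V)).Reachable base (g • base) := by
    intro g
    induction hKtop ▸ Subgroup.mem_top g using Subgroup.closure_induction with
    | mem g hg =>
      exact reachable_of_mem (g • v₀) (hst (Finset.mem_insert_of_mem
        (hKfin.mem_toFinset.mpr ⟨g, hg, rfl⟩)))
    | one => rw [one_smul]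
    | mul a b _ _ ha hb => exact ha.trans (mul_smul a b base ▸ hactΩ.reachable_smul a hb)
    | inv a _ ha => simpa only [inv_smul_smul] using (hactΩ.reachable_smul a⁻¹ ha).symm
  refine ⟨Ω, (SimpleGraph.connected_iff_exists_forall_reachable _).mpr ⟨base, ?_⟩⟩
  rintro ⟨v, hv⟩
  obtain ⟨r, hr, hrv⟩ := Finset.mem_image.mp hv
  obtain ⟨g, rfl⟩ : v ∈ MulAction.orbit G r := MulAction.mem_orbit_symm.mp (Quotient.exact hrv)
  exact (reachable_smul g).trans (hactΩ.reachable_smul g (reachable_of_mem r hr))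

theorem FixesVertex.of_subMulAction {X : SubMulAction G V} (h : FixesVertex G X) :
    FixesVertex G V :=
  let ⟨v, hv⟩ := h
  ⟨v, fun g => congrArg Subtype.val (hv g)⟩

theorem FixesEdge.of_induce {X : SubMulAction G V} (h : FixesEdge G (T.induce (X : Set V))) :
    FixesEdge G T := by
  obtain ⟨e, he, hfix⟩ := h
  induction e using Sym2.ind with | _ v w =>
  exact ⟨s(v, w), he, fun g => congrArg (Sym2.map Subtype.val) (hfix g)⟩

open scoped Pointwise in
theorem neighborSet_smul (hact : ActsByAutomorphisms G T) (g : G) (v : V) :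
    T.neighborSet (g • v) = g • T.neighborSet v := by
  ext w
  rw [Set.mem_smul_set_iff_inv_smul_mem, SimpleGraph.mem_neighborSet, SimpleGraph.mem_neighborSet,
    ← hact g v, smul_inv_smul]

theorem fixesEdge_of_neighborSet_eq_singleton (hconn : T.Preconnected)
    (hact : ActsByAutomorphisms G T) {v : V} {g₀ : G} (hv : T.neighborSet v = {g₀ • v}) :
    FixesEdge G T := by
  have hadj : T.Adj v (g₀ • v) := hv.symm.subset rfl
  have hgv : T.neighborSet (g₀ • v) = {v} := by
    have hsub : (T.neighborSet (g₀ • v)).Subsingleton := by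
      rw [neighborSet_smul hact, hv]
      exact Set.subsingleton_singleton.image _
    exact hsub.eq_singleton_of_mem hadj.symm
  have step : ∀ x y, T.Adj x y → x = v ∨ x = g₀ • v → y = v ∨ y = g₀ • v := by
    rintro x y hxy (rfl | rfl)
    · exact Or.inr (hv.subset hxy)
    · exact Or.inl (hgv.subset hxy)
  have pair : ∀ x, x = v ∨ x = g₀ • v := fun x =>
    (eq_of_forall_adj hconn (fun x => x = v ∨ x = g₀ • v)
      (fun x y hxy => propext ⟨step x y hxy, step y x hxy.symm⟩) v x).mp (Or.inl rfl)
  refine ⟨s(v, g₀ • v), hadj, fun g => ?_⟩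
  have hne : g • v ≠ g • g₀ • v := ((hact g _ _).mpr hadj).ne
  rw [Sym2.map_mk, Sym2.eq_iff]
  have := pair (g • v)
  have := pair (g • g₀ • v)
  grind

theorem fixes_or_connected_induce_compl_orbit (hconn : T.Connected)
    (hact : ActsByAutomorphisms G T) {v : V} (hv : (T.neighborSet v).Subsingleton) :
    (FixesVertex G V ∨ FixesEdge G T) ∨ (T.induce (MulAction.orbit G v)ᶜ).Connected := by
  obtain hempty | ⟨u, hu⟩ := hv.eq_empty_or_singleton
  · have : Subsingleton V := not_nontrivial_iff_subsingleton.mp fun _ => by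
      obtain ⟨u, hu⟩ := hconn.preconnected.exists_adj_of_nontrivial v
      exact hempty.subset hu
    exact Or.inl (Or.inl ⟨v, fun g => Subsingleton.elim _ _⟩)
  by_cases horb : u ∈ MulAction.orbit G v
  · obtain ⟨g, rfl⟩ := horb
    exact Or.inl (Or.inr (fixesEdge_of_neighborSet_eq_singleton hconn.preconnected hact hu))
  · refine Or.inr ((SimpleGraph.connected_iff _).mpr
      ⟨hconn.preconnected.induce_of_degree_eq_one fun w hw => ?_, ⟨u, horb⟩⟩)
    obtain ⟨g, rfl⟩ := Set.notMem_compl_iff.mp hw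
    change (T.neighborSet (g • v)).Subsingleton
    rw [neighborSet_smul hact]
    exact hv.image _

theorem fixes_or_exists_leafless_orbitUnion (hact : ActsByAutomorphisms G T)
    (hΩ : ∃ Ω : Finset (MulAction.orbitRel.Quotient G V),
      (T.induce (orbitUnion Ω : Set V)).Connected) :
    (FixesVertex G V ∨ FixesEdge G T) ∨
      ∃ Ω : Finset (MulAction.orbitRel.Quotient G V),
        (T.induce (orbitUnion Ω : Set V)).Connected ∧
          ∀ w, ((T.induce (orbitUnion Ω : Set V)).neighborSet w).Nontrivial := by
  classical
  obtain ⟨Ω, hconn, hmin⟩ := exists_minimal_of_wellFoundedLT _ hΩ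
  by_cases hleaf : ∀ w, ((T.induce (orbitUnion Ω : Set V)).neighborSet w).Nontrivial
  · exact Or.inr ⟨Ω, hconn, hleaf⟩
  push Not at hleaf
  obtain ⟨v, hv⟩ := hleaf
  obtain (hfix | hfix) | hprune :=
    fixes_or_connected_induce_compl_orbit hconn (hact.induce (orbitUnion Ω)) hv
  · exact Or.inl (Or.inl hfix.of_subMulAction)
  · exact Or.inl (Or.inr hfix.of_induce)
  · let ω : MulAction.orbitRel.Quotient G V := Quotient.mk'' (v : V)
    have not_mem_orbit : ∀ w : orbitUnion Ω,
        w ∉ MulAction.orbit G v ↔ (Quotient.mk'' (w : V) : MulAction.orbitRel.Quotient G V) ≠ ω :=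
      fun w => not_congr (SubMulAction.mem_orbit_subMul_iff.trans
        (Quotient.eq'' (s₁ := MulAction.orbitRel G V)).symm)
    let toErase : (T.induce (orbitUnion Ω : Set V)).induce (MulAction.orbit G v)ᶜ →g
        T.induce (orbitUnion (Ω.erase ω) : Set V) :=
      { toFun w := ⟨w.1.1, Finset.mem_erase.mpr ⟨(not_mem_orbit w).mp w.2, w.1.2⟩⟩
        map_rel' := id }
    have hsurj : Function.Surjective toErase := fun ⟨w, hw⟩ =>
      have hw := Finset.mem_erase.mp hw
      ⟨⟨⟨w, hw.2⟩, (not_mem_orbit ⟨w, hw.2⟩).mpr hw.1⟩, rfl⟩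
    exact absurd (hmin (hprune.map toErase hsurj) (Finset.erase_subset ω Ω) v.2)
      (Finset.notMem_erase ω Ω)

theorem HasLocalCharacters.of_isNilpotent (hact : ActsByAutomorphisms G T)
    (hnil : ∀ v, Group.IsNilpotent (localAction hact v))
    (hcoatomic : ∀ v, IsCoatomic (Subgroup (localAction hact v))) : HasLocalCharacters G T := by
  rintro w x hwx ⟨g, hgw, hgx⟩
  have := hnil w
  have := hcoatomic w
  let toLocal : MulAction.stabilizer G w →* localAction hact w :=
    (localActionHom hact w).rangeRestrict
  let x' : T.neighborSet w := ⟨x, hwx⟩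
  have mem_stab : ∀ h : MulAction.stabilizer G w,
      toLocal h ∈ MulAction.stabilizer (localAction hact w) x' ↔ (h : G) • x = x :=
    fun h => Subtype.ext_iff
  have hne : MulAction.stabilizer (localAction hact w) x' ≠ ⊤ := fun htop =>
    hgx ((mem_stab ⟨g, hgw⟩).mp (htop ▸ Subgroup.mem_top _))
  obtain ⟨p, hp, χ, hχ, hχ_surj⟩ := exists_prime_character_of_ne_top hne
  have : Fact p.Prime := ⟨hp⟩
  refine ⟨p, hp, χ.comp toLocal, fun h hh => hχ ((mem_stab h).mpr hh), fun htriv => ?_⟩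
  obtain ⟨a, ha⟩ := exists_ne (1 : Multiplicative (ZMod p))
  obtain ⟨h, rfl⟩ := hχ_surj.comp (MonoidHom.rangeRestrict_surjective _) a
  exact ha (DFunLike.congr_fun htriv h)

theorem HasLocalCharacters.induce (hloc : HasLocalCharacters G T) (X : SubMulAction G V) :
    HasLocalCharacters (V := X) G (T.induce (X : Set V)) := by
  rintro w x hwx ⟨g, hgw, hgx⟩
  obtain ⟨p, hp, χ, hχ, hχ_ne⟩ := hloc w x hwx
    ⟨g, congrArg Subtype.val hgw, fun h => hgx (Subtype.ext h)⟩
  have hstab : MulAction.stabilizer G w = MulAction.stabilizer G (w : V) :=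
    SubMulAction.stabilizer_of_subMul w
  refine ⟨p, hp, χ.comp (MulEquiv.subgroupCongr hstab : _ →* _),
    fun h hh => hχ _ (congrArg Subtype.val hh), fun htriv => hχ_ne ?_⟩
  ext h
  exact DFunLike.congr_fun htriv ((MulEquiv.subgroupCongr hstab).symm h)

end TreeAction

theorem mainTheorem2_general {G V : Type*} [Group G] [TopologicalSpace G] [IsTopologicalGroup G]
    (hG : TreeAction.IsCompactlyGeneratedGroup G) (T : SimpleGraph V) (hTree : T.IsTree)
    [MulAction G V] [TopologicalSpace V] [DiscreteTopology V] [ContinuousSMul G V]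
    (hT : TreeAction.ActsByAutomorphisms G T)
    (hnil : ∀ v : V, Group.IsNilpotent (TreeAction.localAction hT v))
    (hcoatomic : ∀ v : V, IsCoatomic (Subgroup (TreeAction.localAction hT v))) :
    (TreeAction.FixesVertex G V ∨ TreeAction.FixesEdge G T) ∨
      TreeAction.IsVirtuallyIndicable G := by
  have hopen : ∀ v : V, IsOpen (MulAction.stabilizer G v : Set G) := fun v =>
    (isOpen_discrete {v}).preimage (continuous_id.smul (continuous_const (y := v)))
  refine (TreeAction.fixes_or_exists_leafless_orbitUnion hT
    (TreeAction.exists_connected_orbitUnion hG hTree.connected hT)).imp_right ?_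
  rintro ⟨Ω, hconn, hdeg⟩
  have := TreeAction.finite_quotient_orbitUnion Ω
  refine TreeAction.isVirtuallyIndicable_of_hasLocalCharacters
    (V := TreeAction.orbitUnion Ω) ⟨hconn, hTree.isAcyclic.induce _⟩ (hT.induce _) (fun v => ?_)
    ((TreeAction.HasLocalCharacters.of_isNilpotent hT hnil hcoatomic).induce _) hdeg
  rw [SubMulAction.stabilizer_of_subMul]
  exact hopen v

/-- The vertex set is discrete, so `ContinuousSMul G V` says that the action on the tree is
continuous, i.e. that vertex stabilizers are open. -/
theorem mainTheorem2 {G V : Type*} [Group G] [TopologicalSpace G] [IsTopologicalGroup G]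
    [LocallyCompactSpace G] (hG : TreeAction.IsCompactlyGeneratedGroup G)
    (T : SimpleGraph V) [T.LocallyFinite] (hTree : T.IsTree)
    [MulAction G V] [TopologicalSpace V] [DiscreteTopology V] [ContinuousSMul G V]
    (hT : TreeAction.ActsByAutomorphisms G T)
    (hnil : ∀ v : V, Group.IsNilpotent (TreeAction.localAction hT v)) :
    (TreeAction.FixesVertex G V ∨ TreeAction.FixesEdge G T) ∨
      TreeAction.IsVirtuallyIndicable G :=
  mainTheorem2_general hG T hTree hT hnil fun _ => inferInstance
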